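/- Let $\Omega=\{0,1\}^{\mathbb N}$ with the left shift $\sigma$, let $1<\delta<\gamma$, and put $\zeta(s)=\sum_{n\ge1}n^{-s}$. For $n\ge1$ let $L_n$ (respectively $R_n$) be the set of sequences beginning with $0^n1$ (respectively $1^n0$). The Double Hofbauer potential $g:\Omega\to\mathbb R$ is given by $g=-\gamma\log\frac{n}{n-1}$ on $L_n$ and $g=-\delta\log\frac{n}{n-1}$ on $R_n$ for $n\ge2$, $g=-\log\zeta(\gamma)$ on $L_1$, $g=-\log\zeta(\delta)$ on $R_1$, and $g(0^\infty)=g(1^\infty)=0$. Let $\varphi_1=1+n^{\gamma}\sum_{j\ge2}(j+n-1)^{-\gamma}$ on $L_n$ and $\varphi_1=1+n^{\delta}\sum_{j\ge2}(j+n-1)^{-\delta}$ on $R_n$ $(n\ge1)$. The normalized Jacobian $J$ at $\beta=1$ is defined by $\log J=g+\log\varphi_1-\log(\varphi_1\circ\sigma)$ at the points $x$ with $x,\sigma(x)\notin\{0^\infty,1^\infty\}$, together with $J(0^\infty)=J(1^\infty)=1$ and $J(10^\infty)=J(01^\infty)=0$. For $\psi:\Omega\to\mathbb R$ let $$\mathcal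 L_{\log J}(\psi)(x)=\sum_{\sigma(y)=x}J(y)\,\psi(y),$$ and for $q\in\mathbb N$, $y\in\Omega$, $F\subseteq\Omega$ let $$\mu_q^y(F)=\frac1{Z_q^y}\sum_{\sigma^q(x)=\sigma^q(y)}1_F(x)\prod_{i=0}^{q-1}J(\sigma^i x),\qquad Z_q^y=\sum_{\sigma^q(x)=\sigma^q(y)}\ \prod_{i=0}^{q-1}J(\sigma^i x).$$ Then: 1. For every cylinder set $[a]=[a_0a_1\dots a_{k-1}]\subseteq\Omega$ there is a constant $K_a\in\mathbb R$, depending only on $a,\gamma,\delta$, such that for every $n\ge1$ and every $y\in L_n\cup R_n$ the limit $\lim_{q\to\infty}\mathcal L_{\log J}^q(I_{[a]})(y)$ exists and equals $K_a$. In particular this holds for $[a]=[0]$, with a constant $K=K_0$. 2. For every $\sigma$-periodic point $y\in\Omega$ other than the two fixed points $0^\infty$ and $1^\infty$, the limit $\lim_{q\to\infty}\mu_q^y([0])$ exists and equals $K$. In particular these limits coincide for all such $y$. -/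

import Mathlib

open Filter Topology

noncomputable section

namespace DoubleHofbauer

/-- The symbolic space `{0,1}^ℕ`. -/
abbrev Omega : Type := ℕ → Fin 2

/-- The left shift on `{0,1}^ℕ`. -/
def shift (x : Omega) : Omega := fun i => x (i + 1)

/-- The fixed point `000…` of the shift. -/
def zeroInf : Omega := fun _ => 0

/-- The fixed point `111…` of the shift. -/
def oneInf : Omega := fun _ => 1

/-- The cylinder set of all sequences that begin with the word `a 0, …, a (k - 1)`. -/
def cylinder {k : ℕ} (a : Fin k → Fin 2) : Set Omega := {x | ∀ i : Fin k, x i = a i}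

/-- The cylinder of the sequences that begin with `n` zeros followed by a one. -/
def cylL (n : ℕ) : Set Omega := {x | (∀ i < n, x i = 0) ∧ x n = 1}

/-- The cylinder of the sequences that begin with `n` ones followed by a zero. -/
def cylR (n : ℕ) : Set Omega := {x | (∀ i < n, x i = 1) ∧ x n = 0}

/-- The length of the initial block of equal symbols of `x`; it is `0` when `x` is constant
(see `mem_cylL_iff` and `mem_cylR_iff`). -/
def run (x : Omega) : ℕ := sInf {n | x n ≠ x 0}

/-- The series `∑_{n ≥ 1} 1 / n ^ s`. -/
def zetaSum (s : ℝ) : ℝ := ∑' n : ℕ, 1 / ((n : ℝ) + 1) ^ s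

/-- The Double Hofbauer potential with parameters `γ` and `δ`. -/
def potential (γ δ : ℝ) (x : Omega) : ℝ :=
  if run x = 0 then 0
  else if x 0 = 0 then
    (if run x = 1 then -Real.log (zetaSum γ)
      else -γ * Real.log ((run x : ℝ) / ((run x : ℝ) - 1)))
  else
    (if run x = 1 then -Real.log (zetaSum δ)
      else -δ * Real.log ((run x : ℝ) / ((run x : ℝ) - 1)))

/-- The number `1 + n ^ s * ∑_{j ≥ 2} (j + n - 1) ^ (-s)`. -/
def blockWeight (s : ℝ) (n : ℕ) : ℝ :=
  1 + (n : ℝ) ^ s * ∑' j : ℕ, (((j : ℝ) + 2) + (n : ℝ) - 1) ^ (-s)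

/-- The eigenfunction (for the eigenvalue `1`) of the Ruelle operator of the potential, normalized
so that its free multiplicative constant is `1`. It is infinite at the two fixed points of the
shift; the value given to it there is arbitrary and is not used below. -/
def eigenfunction (γ δ : ℝ) (x : Omega) : ℝ :=
  if x 0 = 0 then blockWeight γ (run x) else blockWeight δ (run x)

/-- The normalized Jacobian `J` with `log J = g + log φ - log (φ ∘ σ)`, where `g` is the potential
and `φ` the eigenfunction, extended by `J = 1` at the fixed points `000…` and `111…` and by
`J = 0` at their other preimages `1000…` and `0111…`. -/
def jacobian (γ δ : ℝ) (x : Omega) : ℝ :=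
  open Classical in
  if x = zeroInf ∨ x = oneInf then 1
  else if shift x = zeroInf ∨ shift x = oneInf then 0
  else Real.exp (potential γ δ x + Real.log (eigenfunction γ δ x)
    - Real.log (eigenfunction γ δ (shift x)))

/-- The Ruelle operator of the potential `log W`, that is
`(ruelle W ψ) x = ∑_{σ y = x} W y * ψ y`. -/
def ruelle (W : Omega → ℝ) (ψ : Omega → ℝ) (x : Omega) : ℝ :=
  ∑ᶠ y ∈ {y : Omega | shift y = x}, W y * ψ y

/-- The sum over all `x` with `σ^n x = σ^n y` of `1_F(x) W(x) W(σ x) ⋯ W(σ^(n-1) x)`. -/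
def gibbsSum (W : Omega → ℝ) (n : ℕ) (y : Omega) (F : Set Omega) : ℝ :=
  ∑ᶠ x ∈ {x : Omega | shift^[n] x = shift^[n] y},
    F.indicator 1 x * ∏ i ∈ Finset.range n, W (shift^[i] x)

/-- The finite volume Gibbs measure of the potential `log W` in the volume `{0, …, n - 1}` with
boundary condition `y`, evaluated at `F`; `gibbsSum W n y Set.univ` is the partition function. -/
def gibbs (W : Omega → ℝ) (n : ℕ) (y : Omega) (F : Set Omega) : ℝ :=
  gibbsSum W n y F / gibbsSum W n y Set.univ

/-- Prepending a symbol. -/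
def cons (c : Fin 2) (x : Omega) : Omega := fun i => Nat.casesOn i c x

theorem preimage_shift (x : Omega) : {y : Omega | shift y = x} = {cons 0 x, cons 1 x} := by
  ext y
  constructor
  · rintro rfl
    have h : y = cons (y 0) (shift y) := by
      funext i
      cases i <;> rfl
    have hy : y 0 = 0 ∨ y 0 = 1 := by omega
    rcases hy with h0 | h0
    · left
      rwa [h0] at h
    · right
      rwa [h0] at h
  · rintro (rfl | rfl) <;> rfl

theorem ruelle_apply (W ψ : Omega → ℝ) (x : Omega) :
    ruelle W ψ x = W (cons 0 x) * ψ (cons 0 x) + W (cons 1 x) * ψ (cons 1 x) := by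
  have hne : cons 0 x ≠ cons 1 x := fun h => by simpa [cons] using congrFun h 0
  rw [ruelle, preimage_shift, finsum_mem_pair hne]

theorem finite_fiber (n : ℕ) (z : Omega) : {x : Omega | shift^[n] x = z}.Finite := by
  induction n with
  | zero => simp
  | succ n ih =>
    have h : {x : Omega | shift^[n + 1] x = z} ⊆
        ⋃ w ∈ {w : Omega | shift^[n] w = z}, {x : Omega | shift x = w} := by
      intro x hx
      simpa using hx
    refine (ih.biUnion fun w _ => ?_).subset h
    rw [preimage_shift]
    exact Set.toFinite _

theorem mem_cylL_iff {n : ℕ} (hn : 1 ≤ n) (x : Omega) : x ∈ cylL n ↔ x 0 = 0 ∧ run x = n := by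
  constructor
  · rintro ⟨h, h1⟩
    have h0 : x 0 = 0 := h 0 hn
    refine ⟨h0, le_antisymm (Nat.sInf_le (by simp [h0, h1])) (le_csInf ⟨n, by simp [h0, h1]⟩ ?_)⟩
    intro m hm
    by_contra hlt
    exact hm (by rw [h m (not_le.1 hlt), h0])
  · rintro ⟨h0, rfl⟩
    have hne : {n | x n ≠ x 0}.Nonempty := Nat.nonempty_of_pos_sInf hn
    refine ⟨fun i hi => ?_, ?_⟩
    · have := Nat.notMem_of_lt_sInf hi
      simpa [h0] using this
    · have h : x (run x) ≠ x 0 := Nat.sInf_mem hne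
      rw [h0] at h
      omega

theorem mem_cylR_iff {n : ℕ} (hn : 1 ≤ n) (x : Omega) : x ∈ cylR n ↔ x 0 = 1 ∧ run x = n := by
  constructor
  · rintro ⟨h, h1⟩
    have h0 : x 0 = 1 := h 0 hn
    refine ⟨h0, le_antisymm (Nat.sInf_le (by simp [h0, h1])) (le_csInf ⟨n, by simp [h0, h1]⟩ ?_)⟩
    intro m hm
    by_contra hlt
    exact hm (by rw [h m (not_le.1 hlt), h0])
  · rintro ⟨h0, rfl⟩
    have hne : {n | x n ≠ x 0}.Nonempty := Nat.nonempty_of_pos_sInf hn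
    refine ⟨fun i hi => ?_, ?_⟩
    · have := Nat.notMem_of_lt_sInf hi
      simpa [h0] using this
    · have h : x (run x) ≠ x 0 := Nat.sInf_mem hne
      rw [h0] at h
      omega

end DoubleHofbauer

end

open DoubleHofbauer

namespace DoubleHofbauer

/-! Away from the two fixed points, the Ruelle operator acts on functions of the initial block (its
symbol and length) as a Markov chain: the block grows by one, or a block of the other symbol starts
with length 1. With T_s(n) = ∑_{m>n} m^(-s), normalizing by the eigenfunction makes the growth
probability T_s(n+1)/T_s(n) (`jacobian_cons_self`), so block lengths have survival function
T_s(n)/T_s(0), with s = γ for zeros and s = δ for ones.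

Splitting at the last start of a block (`iterate_blockOp_eq`) reduces everything to the
probabilities that a block starts at a given time. By `renewal` these tend to the reciprocal of the
mean cycle length, or to 0 if that mean is infinite. In the first case the chain converges to its
stationary law from every state. In the second, since δ < γ, blocks of ones have the heavier tail
and the chain drifts to long blocks of ones, so only the limit of the function along these matters.

Applying the operator k times turns the indicator of a cylinder of length k into a function of the
initial block that has such a limit (`exists_ruelle_cylinder`). The Gibbs sum is the iterated
operator evaluated at σ^q(y) (`gibbsSum_eq`), the partition function is 1, and a periodic orbit is
finite, so convergence at each of its points suffices. -/

/-- The survival function of a block length: it starts at `1`, decreases strictly, and vanishes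
at infinity. -/
structure IsSurvival (t : ℕ → ℝ) : Prop where
  zero : t 0 = 1
  anti : StrictAnti t
  lim : Tendsto t atTop (𝓝 0)

namespace IsSurvival

variable {t : ℕ → ℝ} (ht : IsSurvival t)
include ht

theorem nonneg (n : ℕ) : 0 ≤ t n := ht.anti.antitone.le_of_tendsto ht.lim n

theorem pos (n : ℕ) : 0 < t n := (ht.nonneg (n + 1)).trans_lt (ht.anti n.lt_succ_self)

theorem diff_pos (n : ℕ) : 0 < t n - t (n + 1) := sub_pos.2 (ht.anti n.lt_succ_self)

theorem hasSum_diff : HasSum (fun n => t n - t (n + 1)) 1 := by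
  rw [hasSum_iff_tendsto_nat_of_nonneg fun n => (ht.diff_pos n).le]
  simp_rw [Finset.sum_range_sub', ht.zero]
  simpa using ht.lim.const_sub 1

end IsSurvival

/-! ### The chain of blocks and its renewal equations. -/

/-- The transition operator of the chain of blocks: the current block, of type `i` and length
`n + 1`, grows with probability `t i (n + 1) / t i n` and otherwise a block of the other type
is started. -/
noncomputable def blockOp (t : Fin 2 → ℕ → ℝ) (h : Fin 2 × ℕ → ℝ) (s : Fin 2 × ℕ) : ℝ :=
  t s.1 (s.2 + 1) / t s.1 s.2 * h (s.1, s.2 + 1)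
    + (t s.1 s.2 - t s.1 (s.2 + 1)) / t s.1 s.2 * h (s.1 + 1, 0)

/-- The probability that the chain of blocks started at `s` starts a block of type `i` at
time `q + 1`. -/
noncomputable def entrance (t : Fin 2 → ℕ → ℝ) (s : Fin 2 × ℕ) (i : Fin 2) (q : ℕ) : ℝ :=
  (blockOp t)^[q + 1] (Pi.single (i, 0) 1) s

section chain

variable {t : Fin 2 → ℕ → ℝ} (ht : ∀ i, IsSurvival (t i))
include ht

theorem blockOp_mono {h h' : Fin 2 × ℕ → ℝ} (hh : h ≤ h') : blockOp t h ≤ blockOp t h' := by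
  intro s
  have := (ht s.1).pos s.2
  have := (ht s.1).nonneg (s.2 + 1)
  have := (ht s.1).diff_pos s.2
  unfold blockOp
  gcongr
  · exact hh _
  · exact hh _

theorem blockOp_const (c : ℝ) : blockOp t (fun _ => c) = fun _ => c := by
  funext s
  have := ((ht s.1).pos s.2).ne'
  unfold blockOp
  field_simp
  ring

theorem iterate_blockOp_const (c : ℝ) (q : ℕ) : (blockOp t)^[q] (fun _ => c) = fun _ => c :=
  Function.iterate_fixed (blockOp_const ht c) q

theorem iterate_blockOp_mono (q : ℕ) : Monotone (blockOp t)^[q] :=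
  Monotone.iterate (fun _ _ h => blockOp_mono ht h) q

theorem entrance_nonneg (s : Fin 2 × ℕ) (i : Fin 2) (q : ℕ) : 0 ≤ entrance t s i q := by
  have h0 : (fun _ => 0 : Fin 2 × ℕ → ℝ) ≤ Pi.single (i, 0) 1 := by
    intro x
    by_cases hx : x = (i, 0) <;> simp [hx]
  have := iterate_blockOp_mono ht (q + 1) h0 s
  rwa [iterate_blockOp_const ht] at this

theorem entrance_le_one (s : Fin 2 × ℕ) (i : Fin 2) (q : ℕ) : entrance t s i q ≤ 1 := by
  have h0 : Pi.single (i, 0) 1 ≤ (fun _ => 1 : Fin 2 × ℕ → ℝ) := by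
    intro x
    by_cases hx : x = (i, 0) <;> simp [hx]
  have := iterate_blockOp_mono ht (q + 1) h0 s
  rwa [iterate_blockOp_const ht] at this

/-- Decomposition of the chain of blocks at the last time at which a block was started. -/
theorem iterate_blockOp_eq (s : Fin 2 × ℕ) (q : ℕ) (h : Fin 2 × ℕ → ℝ) :
    (blockOp t)^[q] h s = t s.1 (s.2 + q) / t s.1 s.2 * h (s.1, s.2 + q)
      + ∑ i, ∑ m ∈ Finset.range q, entrance t s i (q - 1 - m) * (t i m * h (i, m)) := by
  induction q generalizing h with
  | zero => simp [div_self ((ht s.1).pos s.2).ne']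
  | succ q ih =>
    -- The induction hypothesis for `blockOp t h`: the factor `t i m` cancels the denominator in
    -- `blockOp`, which separates growth terms from restart terms.
    have key : ∀ h : Fin 2 × ℕ → ℝ, (blockOp t)^[q + 1] h s
        = t s.1 (s.2 + q + 1) / t s.1 s.2 * h (s.1, s.2 + q + 1)
          + (t s.1 (s.2 + q) - t s.1 (s.2 + q + 1)) / t s.1 s.2 * h (s.1 + 1, 0)
          + ∑ i, ((∑ m ∈ Finset.range q, entrance t s i (q - 1 - m)
                * (t i (m + 1) * h (i, m + 1)))
            + (∑ m ∈ Finset.range q, entrance t s i (q - 1 - m) * (t i m - t i (m + 1)))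
                * h (i + 1, 0)) := by
      intro h
      rw [Function.iterate_succ_apply, ih, add_assoc (_ * _)]
      have h1 : ∀ i m, t i m * blockOp t h (i, m)
          = t i (m + 1) * h (i, m + 1) + (t i m - t i (m + 1)) * h (i + 1, 0) := by
        intro i m
        have := ((ht i).pos m).ne'
        unfold blockOp
        field_simp
      rw [div_mul_eq_mul_div, h1]
      simp_rw [h1, mul_add, Finset.sum_add_distrib, Finset.sum_mul]
      simp only [mul_assoc]
      ring
    -- `key` for the unit mass at `(i, 0)`: only restart terms survive, and they add up to the new
    -- entrance probability.
    have hent : ∀ i, entrance t s i q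
        = (t s.1 (s.2 + q) - t s.1 (s.2 + q + 1)) / t s.1 s.2 * (if s.1 + 1 = i then 1 else 0)
          + ∑ m ∈ Finset.range q, entrance t s (i + 1) (q - 1 - m)
            * (t (i + 1) m - t (i + 1) (m + 1)) := by
      intro i
      rw [entrance, key]
      fin_cases i <;> simp [Pi.single_apply, Prod.ext_iff, Fin.sum_univ_two]
    rw [key]
    have h2 : ∀ i, ∑ m ∈ Finset.range (q + 1), entrance t s i (q + 1 - 1 - m) * (t i m * h (i, m))
        = (∑ m ∈ Finset.range q, entrance t s i (q - 1 - m) * (t i (m + 1) * h (i, m + 1)))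
          + entrance t s i q * h (i, 0) := by
      intro i
      rw [Finset.sum_range_succ']
      congr 1
      · refine Finset.sum_congr rfl fun m _ => ?_
        rw [show q + 1 - 1 - (m + 1) = q - 1 - m by omega]
      · simp [(ht i).zero]
    simp_rw [h2, hent]
    obtain ⟨i, n⟩ := s
    fin_cases i <;> simp [Fin.sum_univ_two, ← add_assoc]
    all_goals ring

/-- A block of type `i` starts exactly when a block of the other type ends: either the initial one,
or one of length `m + 1` started `m + 1` steps earlier. -/
theorem entrance_eq (s : Fin 2 × ℕ) (i : Fin 2) (q : ℕ) :
    entrance t s i q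
      = (if s.1 + 1 = i then (t s.1 (s.2 + q) - t s.1 (s.2 + q + 1)) / t s.1 s.2 else 0)
        + ∑ m ∈ Finset.range q, entrance t s (i + 1) (q - 1 - m)
          * (t (i + 1) m - t (i + 1) (m + 1)) := by
  have h1 : ∀ j m, t j m * blockOp t (Pi.single (i, 0) 1) (j, m)
      = if j + 1 = i then t j m - t j (m + 1) else 0 := by
    intro j m
    have := ((ht j).pos m).ne'
    unfold blockOp
    simp only [Pi.single_apply, Prod.ext_iff]
    split_ifs <;> simp_all <;> field_simp
  rw [entrance, Function.iterate_succ_apply, iterate_blockOp_eq ht, div_mul_eq_mul_div, h1]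
  simp_rw [h1]
  congr 1
  · split_ifs <;> simp [add_assoc]
  · fin_cases i <;> simp [Fin.sum_univ_two]

theorem sum_entrance_eq_one (s : Fin 2 × ℕ) (q : ℕ) :
    t s.1 (s.2 + q) / t s.1 s.2
      + ∑ i, ∑ m ∈ Finset.range q, entrance t s i (q - 1 - m) * t i m = 1 := by
  have := iterate_blockOp_eq ht s q (fun _ => 1)
  rw [iterate_blockOp_const ht] at this
  simpa using this.symm

theorem tendsto_initial (s : Fin 2 × ℕ) :
    Tendsto (fun q => t s.1 (s.2 + q) / t s.1 s.2) atTop (𝓝 0) := by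
  have h := ((ht s.1).lim.comp (tendsto_add_atTop_nat s.2)).div_const (t s.1 s.2)
  simpa [Function.comp_def, add_comm] using h

end chain

/-! ### Limits of convolutions. -/

/-- Dominated convergence for the convolution of a bounded sequence with a summable one. -/
theorem tendsto_sum_convolution {b w g : ℕ → ℝ} {B : ℝ} (hb : ∀ q, |b q| ≤ B)
    (hw : Summable w) {l : Filter ℕ} (hl : l ≤ atTop)
    (hg : ∀ m, Tendsto (fun q => b (q - 1 - m)) l (𝓝 (g m))) :
    Tendsto (fun q => ∑ m ∈ Finset.range q, b (q - 1 - m) * w m) l (𝓝 (∑' m, g m * w m)) := by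
  have h1 : ∀ q, ∑ m ∈ Finset.range q, b (q - 1 - m) * w m
      = ∑' m, if m < q then b (q - 1 - m) * w m else 0 := by
    intro q
    rw [tsum_eq_sum (s := Finset.range q)]
    · exact Finset.sum_congr rfl fun m hm => by simp [Finset.mem_range.1 hm]
    · intro m hm
      simp [Finset.mem_range.not.1 hm]
  simp_rw [h1]
  refine tendsto_tsum_of_dominated_convergence (hw.abs.mul_left B) ?_ ?_
  · intro m
    refine ((hg m).mul_const (w m)).congr' ?_
    filter_upwards [hl (eventually_gt_atTop m)] with q hq
    rw [if_pos hq]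
  · refine Eventually.of_forall fun q m => ?_
    split_ifs
    · rw [Real.norm_eq_abs, abs_mul]
      exact mul_le_mul_of_nonneg_right (hb _) (abs_nonneg _)
    · simpa using mul_nonneg ((abs_nonneg _).trans (hb 0)) (abs_nonneg (w m))

/-- The convolution of a null sequence with weights that keep it bounded, damped by another null
sequence, tends to zero. -/
theorem tendsto_sum_convolution_zero {b w g : ℕ → ℝ} {C : ℝ} (hb0 : ∀ q, 0 ≤ b q)
    (hw0 : ∀ q, 0 ≤ w q) (hb : Tendsto b atTop (𝓝 0))
    (hC : ∀ q, ∑ m ∈ Finset.range q, b (q - 1 - m) * w m ≤ C) (hg : Tendsto g atTop (𝓝 0)) :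
    Tendsto (fun q => ∑ m ∈ Finset.range q, b (q - 1 - m) * (w m * g m)) atTop (𝓝 0) := by
  have hC0 : 0 ≤ C := by simpa using hC 0
  rw [Metric.tendsto_atTop]
  intro ε hε
  -- For `m ≥ N` the smallness of `g` is used against the bound `C`; the finitely many other terms
  -- vanish because `b` does.
  obtain ⟨N, hN⟩ := Metric.tendsto_atTop.1 hg (ε / 2 / (C + 1)) (by positivity)
  have hlim : Tendsto (fun q => ∑ m ∈ Finset.range N, b (q - 1 - m) * (w m * |g m|)) atTop (𝓝 0) := by
    rw [show (0 : ℝ) = ∑ m ∈ Finset.range N, 0 * (w m * |g m|) by simp]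
    refine tendsto_finsetSum _ fun m _ => Tendsto.mul_const _ (hb.comp ?_)
    simpa [Nat.sub_sub] using tendsto_sub_atTop_nat (1 + m)
  obtain ⟨Q, hQ⟩ := Metric.tendsto_atTop.1 hlim (ε / 2) (by positivity)
  refine ⟨max Q N, fun q hq => ?_⟩
  have hq1 := hQ q (le_of_max_le_left hq)
  have hqN : N ≤ q := le_of_max_le_right hq
  rw [Real.dist_eq, sub_zero] at hq1 ⊢
  have hsplit : ∀ m ∈ Finset.range q, |b (q - 1 - m) * (w m * g m)|
      ≤ (if m ∈ Finset.range N then b (q - 1 - m) * (w m * |g m|) else 0)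
        + ε / 2 / (C + 1) * (b (q - 1 - m) * w m) := by
    intro m _
    rw [abs_mul, abs_mul, abs_of_nonneg (hb0 _), abs_of_nonneg (hw0 _)]
    have h1 : 0 ≤ b (q - 1 - m) * w m := mul_nonneg (hb0 _) (hw0 _)
    split_ifs with hm
    · have : 0 ≤ ε / 2 / (C + 1) := by positivity
      nlinarith [mul_nonneg this h1]
    · have h2 := hN m (by simpa using hm)
      rw [Real.dist_eq, sub_zero] at h2
      nlinarith [mul_le_mul_of_nonneg_left h2.le h1]
  calc |∑ m ∈ Finset.range q, b (q - 1 - m) * (w m * g m)|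
      ≤ ∑ m ∈ Finset.range q, |b (q - 1 - m) * (w m * g m)| := Finset.abs_sum_le_sum_abs _ _
    _ ≤ _ := Finset.sum_le_sum hsplit
    _ = ∑ m ∈ Finset.range N, b (q - 1 - m) * (w m * |g m|)
        + ε / 2 / (C + 1) * ∑ m ∈ Finset.range q, b (q - 1 - m) * w m := by
      rw [Finset.sum_add_distrib, ← Finset.mul_sum, Finset.sum_ite_mem,
        Finset.inter_eq_right.2 (Finset.range_subset_range.2 hqN)]
    _ < ε / 2 + ε / 2 := by
      refine add_lt_add_of_lt_of_le ((le_abs_self _).trans_lt hq1) ?_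
      calc ε / 2 / (C + 1) * _ ≤ ε / 2 / (C + 1) * (C + 1) := by
            gcongr
            exact (hC q).trans (by linarith)
        _ = ε / 2 := by field_simp
    _ = ε := by ring

/-! ### The renewal theorem, by extremal cluster values. -/

/-- The cluster values of two real sequences. -/
def clusterSet (a : Fin 2 → ℕ → ℝ) : Set ℝ := {x | ∃ i, MapClusterPt x atTop (a i)}

theorem clusterSet_subset {a : Fin 2 → ℕ → ℝ} (ha : ∀ i q, a i q ∈ Set.Icc (0 : ℝ) 1) :
    clusterSet a ⊆ Set.Icc 0 1 := by
  rintro x ⟨i, hx⟩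
  obtain ⟨U, -, hU⟩ := mapClusterPt_iff_ultrafilter.1 hx
  exact isClosed_Icc.mem_of_tendsto hU (Eventually.of_forall (ha i))

theorem isCompact_clusterSet {a : Fin 2 → ℕ → ℝ} (ha : ∀ i q, a i q ∈ Set.Icc (0 : ℝ) 1) :
    IsCompact (clusterSet a) := by
  refine isCompact_Icc.of_isClosed_subset ?_ (clusterSet_subset ha)
  have : clusterSet a = ⋃ i, {x | MapClusterPt x atTop (a i)} := by
    ext x; simp [clusterSet]
  rw [this]
  exact isClosed_iUnion_of_finite fun i => isClosed_setOfPred_clusterPt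

theorem exists_tendsto_ultrafilter {b : ℕ → ℝ} (hb : ∀ q, b q ∈ Set.Icc (0 : ℝ) 1)
    (U : Ultrafilter ℕ) : ∃ x, Tendsto b U (𝓝 x) := by
  obtain ⟨x, -, hx⟩ := (isCompact_Icc (a := (0 : ℝ)) (b := 1)).ultrafilter_le_nhds (U.map b)
    (by
      rw [Ultrafilter.coe_map, le_principal_iff, mem_map]
      exact Eventually.of_forall hb)
  exact ⟨x, hx⟩

section renewal

variable {t a : Fin 2 → ℕ → ℝ} {e : Fin 2 → ℕ → ℝ} {d : ℕ → ℝ}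

/-- If one of two sequences which satisfy a pair of renewal equations tends to an extremal
cluster value along an ultrafilter, then so do the shifts of both by at least two. -/
theorem tendsto_of_extremal (ht : ∀ i, IsSurvival (t i)) (ha : ∀ i q, a i q ∈ Set.Icc (0 : ℝ) 1)
    (he : ∀ i, Tendsto (e i) atTop (𝓝 0))
    (hae : ∀ i q, a i q = e i q
      + ∑ m ∈ Finset.range q, a (i + 1) (q - 1 - m) * (t (i + 1) m - t (i + 1) (m + 1)))
    {c x : ℝ} (hc : c ≠ 0) (hx : ∀ y ∈ clusterSet a, 0 ≤ c * (x - y))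
    {U : Ultrafilter ℕ} (hU : (U : Filter ℕ) ≤ atTop) {i : Fin 2} (hi : Tendsto (a i) U (𝓝 x))
    (j : Fin 2) (m : ℕ) : Tendsto (fun q => a j (q - (m + 2))) U (𝓝 x) := by
  have hUk : ∀ k, Tendsto (fun q => q - k) (U : Filter ℕ) atTop := fun k =>
    (tendsto_sub_atTop_nat k).mono_left hU
  choose A hA using fun i k => exists_tendsto_ultrafilter (fun q => ha i (q - k)) U
  -- The sign of `c` treats maximal and minimal cluster values at once.
  have hAx : ∀ j k, 0 ≤ c * (x - A j k) := by
    intro j k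
    refine hx _ ⟨j, mapClusterPt_iff_ultrafilter.2 ⟨U.map fun q => q - k, hUk k, ?_⟩⟩
    simpa [Function.comp_def] using hA j k
  -- In the limit the renewal equation writes `x` as an average, with strictly positive weights of
  -- sum 1, of values none of which passes `x`; hence all equal `x`.
  have hstep : ∀ j k, A j k = x → ∀ m, A (j + 1) (k + 1 + m) = x := by
    intro j k hjk m
    set f : ℕ → ℝ := fun m => t (j + 1) m - t (j + 1) (m + 1) with hf
    have hs : HasSum f 1 := (ht (j + 1)).hasSum_diff
    have hlim := tendsto_sum_convolution (b := a (j + 1)) (B := 1) (w := f)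
      (g := fun m => A (j + 1) (k + 1 + m))
      (fun q => abs_le.2 ⟨by linarith [(ha (j + 1) q).1], (ha (j + 1) q).2⟩) hs.summable
      (l := (U : Filter ℕ).map fun q => q - k) (hUk k) (by
        intro m
        simpa [Function.comp_def, Nat.sub_sub, add_assoc] using hA (j + 1) (k + 1 + m))
    have h2 : Tendsto (fun q => a j (q - k)) U (𝓝 (0 + ∑' m, A (j + 1) (k + 1 + m) * f m)) := by
      refine Tendsto.congr (fun q => (hae j (q - k)).symm) ?_
      exact ((he j).comp (hUk k)).add (by simpa [Function.comp_def] using hlim)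
    have h3 : x = ∑' m, A (j + 1) (k + 1 + m) * f m := by
      rw [← hjk, tendsto_nhds_unique (hA j k) h2, zero_add]
    have hAb : ∀ k, A (j + 1) k ∈ Set.Icc (0 : ℝ) 1 := fun k =>
      isClosed_Icc.mem_of_tendsto (hA (j + 1) k) (Eventually.of_forall fun q => ha _ _)
    have hsum : Summable fun m => A (j + 1) (k + 1 + m) * f m := by
      refine Summable.of_nonneg_of_le (fun m => mul_nonneg (hAb _).1 ((ht (j + 1)).diff_pos m).le)
        (fun m => ?_) hs.summable
      exact mul_le_of_le_one_left ((ht (j + 1)).diff_pos m).le (hAb _).2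
    have h4 : HasSum (fun m => c * (x - A (j + 1) (k + 1 + m)) * f m) 0 := by
      have h := hsum.hasSum
      rw [← h3] at h
      have := ((hs.mul_left x).sub h).mul_left c
      rw [mul_one, sub_self, mul_zero] at this
      exact this.congr_fun fun m => by ring
    have h5 := (hasSum_zero_iff_of_nonneg fun m =>
      mul_nonneg (hAx (j + 1) (k + 1 + m)) ((ht (j + 1)).diff_pos m).le).1 h4
    have h6 := congrFun h5 m
    simp only [Pi.zero_apply, mul_eq_zero, hc, false_or, ((ht (j + 1)).diff_pos m).ne',
      or_false] at h6
    linarith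
  have h0 : A i 0 = x := tendsto_nhds_unique (hA i 0) (by simpa using hi)
  -- One use reaches the other type at all shifts from 1 on, a second use the same type at all
  -- shifts from 2 on; hence the `m + 2`.
  have h1 := hstep i 0 h0
  have h1' := fun m => hstep (i + 1) (0 + 1 + m) (h1 m)
  have hj : j = i + 1 ∨ j = i + 1 + 1 := by clear * -; revert i j; decide
  rcases hj with rfl | rfl
  · convert hA (i + 1) (m + 2) using 2
    rw [← h1 (m + 1)]; congr 1; omega
  · convert hA (i + 1 + 1) (m + 2) using 2
    rw [← h1' 0 m]; congr 1; omega

/-- The common limit of the shifts is the reciprocal of the mean cycle length. -/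
theorem extremal_mul_tsum (ht : ∀ i, IsSurvival (t i))
    (ha : ∀ i q, a i q ∈ Set.Icc (0 : ℝ) 1)
    (hd : Tendsto d atTop (𝓝 0))
    (had : ∀ q, d q + ∑ i, ∑ m ∈ Finset.range q, a i (q - 1 - m) * t i m = 1)
    {x : ℝ} {U : Ultrafilter ℕ} (hU : (U : Filter ℕ) ≤ atTop)
    (hx : ∀ j m, Tendsto (fun q => a j (q - (m + 2))) U (𝓝 x)) :
    (∀ j, Summable (t j)) ∧ x * ∑ j, ∑' m, t j m = 1 ∨ ¬ (∀ j, Summable (t j)) ∧ x = 0 := by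
  have hU1 : Tendsto (fun q => q - 1) (U : Filter ℕ) atTop :=
    (tendsto_sub_atTop_nat 1).mono_left hU
  -- `hx` covers only shifts of at least two, so `had` is used at `q - 1`.
  have hx' : ∀ j m, Tendsto (fun q => a j (q - 1 - 1 - m)) U (𝓝 x) := by
    intro j m
    refine (hx j m).congr fun q => ?_
    congr 1; omega
  by_cases hs : ∀ j, Summable (t j)
  · refine Or.inl ⟨hs, ?_⟩
    have h1 : ∀ j, Tendsto (fun q => ∑ m ∈ Finset.range (q - 1), a j (q - 1 - 1 - m) * t j m) U
        (𝓝 (∑' m, x * t j m)) := by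
      intro j
      have := tendsto_sum_convolution (b := a j) (B := 1) (w := t j) (g := fun m => x)
        (fun q => abs_le.2 ⟨by linarith [(ha j q).1], (ha j q).2⟩) (hs j)
        (l := (U : Filter ℕ).map fun q => q - 1) hU1 (fun m => by
          simpa [Function.comp_def] using hx' j m)
      simpa [Function.comp_def] using this
    have h2 := (hd.comp hU1).add (tendsto_finsetSum Finset.univ fun j _ => h1 j)
    have h3 : Tendsto (fun _ : ℕ => (1 : ℝ)) (U : Filter ℕ)
        (𝓝 (0 + ∑ j, ∑' m, x * t j m)) := h2.congr fun q => had (q - 1)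
    rw [tendsto_nhds_unique h3 tendsto_const_nhds |>.symm, zero_add, Finset.mul_sum]
    simp_rw [tsum_mul_left]
  · refine Or.inr ⟨hs, ?_⟩
    push Not at hs
    obtain ⟨j, hj⟩ := hs
    have hx0 : 0 ≤ x := ge_of_tendsto (hx j 0) (Eventually.of_forall fun q => (ha _ _).1)
    -- A positive `x` would bound the partial sums of the divergent series.
    have hxM : ∀ N, x * ∑ m ∈ Finset.range N, t j m ≤ 1 := by
      intro N
      have h1 : Tendsto (fun q => ∑ m ∈ Finset.range N, a j (q - 1 - 1 - m) * t j m) U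
          (𝓝 (∑ m ∈ Finset.range N, x * t j m)) :=
        tendsto_finsetSum _ fun m _ => (hx' j m).mul_const _
      rw [Finset.mul_sum]
      refine le_of_tendsto_of_tendsto h1 (by simpa using (hd.comp hU1).const_sub 1) ?_
      filter_upwards [hU1 (eventually_ge_atTop N)] with q hq
      have hnn : ∀ k, ∀ m ∈ Finset.range (q - 1), 0 ≤ a k (q - 1 - 1 - m) * t k m :=
        fun k m _ => mul_nonneg (ha _ _).1 ((ht k).nonneg m)
      have h2 : ∑ m ∈ Finset.range N, a j (q - 1 - 1 - m) * t j m
          ≤ ∑ m ∈ Finset.range (q - 1), a j (q - 1 - 1 - m) * t j m :=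
        Finset.sum_le_sum_of_subset_of_nonneg (Finset.range_subset_range.2 hq)
          fun m hm _ => hnn j m hm
      have h3 := Finset.single_le_sum (fun k _ => Finset.sum_nonneg (hnn k)) (Finset.mem_univ j)
      have h4 := had (q - 1)
      linarith
    by_contra hne
    have hxp : 0 < x := lt_of_le_of_ne hx0 (Ne.symm hne)
    refine hj (summable_of_sum_range_le (c := 1 / x) (ht j).nonneg fun N => ?_)
    rw [le_div_iff₀ hxp, mul_comm]
    exact hxM N

/-- The renewal theorem of Erdős, Feller and Pollard, for two alternating kinds of blocks. -/
theorem renewal (ht : ∀ i, IsSurvival (t i)) (ha : ∀ i q, a i q ∈ Set.Icc (0 : ℝ) 1)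
    (he : ∀ i, Tendsto (e i) atTop (𝓝 0))
    (hae : ∀ i q, a i q = e i q
      + ∑ m ∈ Finset.range q, a (i + 1) (q - 1 - m) * (t (i + 1) m - t (i + 1) (m + 1)))
    (hd : Tendsto d atTop (𝓝 0))
    (had : ∀ q, d q + ∑ i, ∑ m ∈ Finset.range q, a i (q - 1 - m) * t i m = 1) :
    ((∀ j, Summable (t j)) → ∀ i, Tendsto (a i) atTop (𝓝 (∑ j, ∑' m, t j m)⁻¹))
      ∧ (¬ (∀ j, Summable (t j)) → ∀ i, Tendsto (a i) atTop (𝓝 0)) := by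
  have hne : (clusterSet a).Nonempty := by
    obtain ⟨x, hx⟩ := exists_tendsto_ultrafilter (ha 0) (Ultrafilter.of atTop)
    exact ⟨x, 0, mapClusterPt_iff_ultrafilter.2 ⟨_, Ultrafilter.of_le _, hx⟩⟩
  -- The greatest and the least cluster value satisfy the same condition, which determines them, so
  -- they coincide.
  have hval : ∀ c ≠ 0, ∀ x ∈ clusterSet a, (∀ y ∈ clusterSet a, 0 ≤ c * (x - y)) →
      (∀ j, Summable (t j)) ∧ x * ∑ j, ∑' m, t j m = 1 ∨ ¬ (∀ j, Summable (t j)) ∧ x = 0 := by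
    rintro c hc x ⟨i, hi⟩ hx
    obtain ⟨U, hU, hi⟩ := mapClusterPt_iff_ultrafilter.1 hi
    exact extremal_mul_tsum ht ha hd had hU (tendsto_of_extremal ht ha he hae hc hx hU hi)
  obtain ⟨M, hM, hM'⟩ := (isCompact_clusterSet ha).exists_isGreatest hne
  obtain ⟨L, hL, hL'⟩ := (isCompact_clusterSet ha).exists_isLeast hne
  have h1 := hval 1 one_ne_zero M hM fun y hy => by linarith [hM' hy]
  have h2 := hval (-1) (by norm_num) L hL fun y hy => by linarith [hL' hy]
  have key : ∀ z, M = z → L = z → ∀ i, Tendsto (a i) atTop (𝓝 z) := by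
    rintro z rfl hLz i
    rw [tendsto_iff_ultrafilter]
    intro U hU
    obtain ⟨x, hx⟩ := exists_tendsto_ultrafilter (ha i) U
    have hxC : x ∈ clusterSet a := ⟨i, mapClusterPt_iff_ultrafilter.2 ⟨U, hU, hx⟩⟩
    rwa [le_antisymm (hLz ▸ hL' hxC) (hM' hxC)]
  constructor
  · intro hs
    rcases h1 with h1 | h1
    · rcases h2 with h2 | h2
      · exact key _ (eq_inv_of_mul_eq_one_left h1.2) (eq_inv_of_mul_eq_one_left h2.2)
      · exact absurd hs h2.1
    · exact absurd hs h1.1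
  · intro hs
    rcases h1 with h1 | h1
    · exact absurd h1.1 hs
    · rcases h2 with h2 | h2
      · exact absurd h2.1 hs
      · exact key _ h1.2 h2.2

end renewal

/-! ### Convergence of the chain of blocks. -/

variable {t : Fin 2 → ℕ → ℝ}

theorem tendsto_entrance (ht : ∀ i, IsSurvival (t i)) (s : Fin 2 × ℕ) :
    ((∀ j, Summable (t j)) → ∀ i, Tendsto (entrance t s i) atTop (𝓝 (∑ j, ∑' m, t j m)⁻¹))
      ∧ (¬ (∀ j, Summable (t j)) → ∀ i, Tendsto (entrance t s i) atTop (𝓝 0)) := by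
  refine renewal ht (fun i q => ⟨entrance_nonneg ht s i q, entrance_le_one ht s i q⟩)
    (fun i => ?_) (entrance_eq ht s) (tendsto_initial ht s) (sum_entrance_eq_one ht s)
  split_ifs
  · have h := (tendsto_initial ht s).sub ((tendsto_initial ht s).comp (tendsto_add_atTop_nat 1))
    simpa [Function.comp_def, sub_div, add_assoc] using h
  · exact tendsto_const_nhds

/-- The convergence of the chain of blocks when the mean block lengths are finite. -/
theorem tendsto_iterate_blockOp_of_summable (ht : ∀ i, IsSurvival (t i))
    (hs : ∀ j, Summable (t j)) {h : Fin 2 × ℕ → ℝ} {B : ℝ} (hB : ∀ s, |h s| ≤ B)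
    (s : Fin 2 × ℕ) :
    Tendsto (fun q => (blockOp t)^[q] h s) atTop
      (𝓝 (∑ i, ∑' m, (∑ j, ∑' m, t j m)⁻¹ * (t i m * h (i, m)))) := by
  simp_rw [iterate_blockOp_eq ht]
  rw [← zero_add (∑ i, _)]
  refine Tendsto.add ?_ (tendsto_finsetSum _ fun i _ => ?_)
  · simp_rw [mul_comm (t s.1 (s.2 + _) / _)]
    exact bdd_le_mul_tendsto_zero' B (Eventually.of_forall fun q => hB _) (tendsto_initial ht s)
  · refine tendsto_sum_convolution (b := entrance t s i) (B := 1)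
      (w := fun m => t i m * h (i, m)) (fun q => ?_) ?_ le_rfl fun m => ?_
    · exact abs_le.2 ⟨by linarith [entrance_nonneg ht s i q], entrance_le_one ht s i q⟩
    · refine ((hs i).mul_right B).of_norm_bounded fun m => ?_
      rw [Real.norm_eq_abs, abs_mul, abs_of_nonneg ((ht i).nonneg m)]
      exact mul_le_mul_of_nonneg_left (hB _) ((ht i).nonneg m)
    · refine ((tendsto_entrance ht s).1 hs i).comp ?_
      simpa [Nat.sub_sub] using tendsto_sub_atTop_nat (1 + m)

theorem sum_entrance_le_one (ht : ∀ i, IsSurvival (t i)) (s : Fin 2 × ℕ) (i : Fin 2) (q : ℕ) :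
    ∑ m ∈ Finset.range q, entrance t s i (q - 1 - m) * t i m ≤ 1 := by
  have h1 := sum_entrance_eq_one ht s q
  have h2 : 0 ≤ t s.1 (s.2 + q) / t s.1 s.2 := div_nonneg ((ht _).nonneg _) ((ht _).nonneg _)
  have h3 := Finset.single_le_sum (f := fun i => ∑ m ∈ Finset.range q,
    entrance t s i (q - 1 - m) * t i m) (fun k _ => Finset.sum_nonneg fun m _ =>
      mul_nonneg (entrance_nonneg ht s k _) ((ht k).nonneg m)) (Finset.mem_univ i)
  linarith

/-- A new block of type `0` has length one with probability `t 0 0 - t 0 1`, and then a block of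
type `1` starts one step later. -/
theorem entrance_le (ht : ∀ i, IsSurvival (t i)) (s : Fin 2 × ℕ) (q : ℕ) :
    entrance t s 0 q ≤ (t 0 0 - t 0 1)⁻¹ * entrance t s 1 (q + 1) := by
  have h0 : 0 < t 0 0 - t 0 1 := (ht 0).diff_pos 0
  rw [← div_eq_inv_mul, le_div_iff₀ h0, entrance_eq ht s 1 (q + 1)]
  have h1 := Finset.single_le_sum (f := fun m => entrance t s (1 + 1) (q + 1 - 1 - m)
      * (t (1 + 1) m - t (1 + 1) (m + 1)))
    (fun m _ => mul_nonneg (entrance_nonneg ht s _ _) ((ht _).diff_pos m).le)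
    (Finset.mem_range.2 q.succ_pos)
  have h2 : 0 ≤ if s.1 + 1 = 1 then
      (t s.1 (s.2 + (q + 1)) - t s.1 (s.2 + (q + 1) + 1)) / t s.1 s.2 else 0 := by
    split_ifs
    · exact div_nonneg ((ht _).diff_pos _).le ((ht _).nonneg _)
    · exact le_rfl
  have h3 : (1 + 1 : Fin 2) = 0 := rfl
  simp only [h3, Nat.add_sub_cancel, Nat.sub_zero, zero_add] at h1 ⊢
  linarith

/-- The convergence of the chain of blocks when some mean block length is infinite and the blocks
of type `1` have the heavier tail. -/
theorem tendsto_iterate_blockOp_of_not_summable (ht : ∀ i, IsSurvival (t i))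
    (hs : ¬ ∀ j, Summable (t j)) (h01 : Tendsto (fun n => t 0 n / t 1 n) atTop (𝓝 0))
    {h : Fin 2 × ℕ → ℝ} {B c : ℝ} (hB : ∀ s, |h s| ≤ B)
    (hc : Tendsto (fun n => h (1, n)) atTop (𝓝 c)) (s : Fin 2 × ℕ) :
    Tendsto (fun q => (blockOp t)^[q] h s) atTop (𝓝 c) := by
  have hent := (tendsto_entrance ht s).2 hs
  have hsplit : ∀ q, (blockOp t)^[q] h s
      = t s.1 (s.2 + q) / t s.1 s.2 * (h (s.1, s.2 + q) - c)
        + ∑ i, ∑ m ∈ Finset.range q, entrance t s i (q - 1 - m) * (t i m * (h (i, m) - c)) + c := by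
    intro q
    have h1 := iterate_blockOp_eq ht s q (fun _ => c)
    rw [iterate_blockOp_const ht] at h1
    rw [iterate_blockOp_eq ht]
    simp only [mul_sub, Finset.sum_sub_distrib]
    linarith
  have hBc : ∀ s, |h s - c| ≤ B + |c| := fun s => (abs_sub _ _).trans (by linarith [hB s])
  simp_rw [hsplit, Fin.sum_univ_two]
  have hA := bdd_le_mul_tendsto_zero' (f := fun q => h (s.1, s.2 + q) - c) (B + |c|)
    (Eventually.of_forall fun q => hBc _) (tendsto_initial ht s)
  have h1 := tendsto_sum_convolution_zero (entrance_nonneg ht s 1) (ht 1).nonneg (hent 1)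
    (sum_entrance_le_one ht s 1) (g := fun m => h (1, m) - c) (by simpa using hc.sub_const c)
  have h0 := tendsto_sum_convolution_zero (entrance_nonneg ht s 1) (ht 1).nonneg (hent 1)
    (sum_entrance_le_one ht s 1) h01
  -- By `entrance_le`, starts of type `0` are controlled by starts of type `1` one step later;
  -- writing `t 0 m` as `t 1 m` times a null ratio brings in `h0`, at index `q + 1`.
  have h0' : Tendsto (fun q => ∑ m ∈ Finset.range q,
      entrance t s 0 (q - 1 - m) * (t 0 m * (h (0, m) - c))) atTop (𝓝 0) := by
    have hlim := (h0.comp (tendsto_add_atTop_nat 1)).const_mul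
      ((t 0 0 - t 0 1)⁻¹ * (B + |c|))
    rw [mul_zero] at hlim
    refine squeeze_zero_norm (fun q => ?_) hlim
    have hnn : ∀ m, 0 ≤ entrance t s 1 (q - m) * (t 1 m * (t 0 m / t 1 m)) := fun m =>
      mul_nonneg (entrance_nonneg ht s _ _)
        (mul_nonneg ((ht 1).nonneg m) (div_nonneg ((ht 0).nonneg m) ((ht 1).nonneg m)))
    have hBn : 0 ≤ B + |c| := (abs_nonneg _).trans (hBc s)
    have h0p : 0 < t 0 0 - t 0 1 := (ht 0).diff_pos 0
    calc ‖∑ m ∈ Finset.range q, entrance t s 0 (q - 1 - m) * (t 0 m * (h (0, m) - c))‖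
        ≤ ∑ m ∈ Finset.range q, ‖entrance t s 0 (q - 1 - m) * (t 0 m * (h (0, m) - c))‖ :=
          norm_sum_le _ _
      _ ≤ ∑ m ∈ Finset.range q, (t 0 0 - t 0 1)⁻¹ * (B + |c|)
            * (entrance t s 1 (q - m) * (t 1 m * (t 0 m / t 1 m))) := by
          refine Finset.sum_le_sum fun m hm => ?_
          have hqm : q - 1 - m + 1 = q - m := by have := Finset.mem_range.1 hm; omega
          have h2 := entrance_le ht s (q - 1 - m)
          rw [hqm] at h2
          rw [Real.norm_eq_abs, abs_mul, abs_mul, abs_of_nonneg (entrance_nonneg ht s _ _),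
            abs_of_nonneg ((ht 0).nonneg m), mul_div_cancel₀ _ ((ht 1).pos m).ne']
          calc entrance t s 0 (q - 1 - m) * (t 0 m * |h (0, m) - c|)
              ≤ ((t 0 0 - t 0 1)⁻¹ * entrance t s 1 (q - m)) * (t 0 m * (B + |c|)) :=
                mul_le_mul h2 (mul_le_mul_of_nonneg_left (hBc _) ((ht 0).nonneg m))
                  (mul_nonneg ((ht 0).nonneg m) (abs_nonneg _))
                  (mul_nonneg (inv_nonneg.2 h0p.le) (entrance_nonneg ht s _ _))
            _ = _ := by ring
      _ ≤ ∑ m ∈ Finset.range (q + 1), (t 0 0 - t 0 1)⁻¹ * (B + |c|)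
            * (entrance t s 1 (q - m) * (t 1 m * (t 0 m / t 1 m))) :=
          Finset.sum_le_sum_of_subset_of_nonneg (Finset.range_subset_range.2 q.le_succ)
            fun m _ _ => mul_nonneg (mul_nonneg (inv_nonneg.2 h0p.le) hBn) (hnn m)
      _ = _ := by rw [← Finset.mul_sum]; simp
  simp_rw [mul_comm (t s.1 (s.2 + _) / _)]
  simpa using (hA.add (h0'.add h1)).add_const c

/-- The functions of the state to which the convergence theorem applies. -/
structure Admissible (h : Fin 2 × ℕ → ℝ) : Prop where
  bounded : ∃ B, ∀ s, |h s| ≤ B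
  -- Needed when a mean block length is infinite: the limit `c` is then the limit of the iterates.
  convergent : ∃ c, Tendsto (fun n => h (1, n)) atTop (𝓝 c)

theorem exists_tendsto_iterate_blockOp (ht : ∀ i, IsSurvival (t i))
    (h01 : Tendsto (fun n => t 0 n / t 1 n) atTop (𝓝 0))
    {h : Fin 2 × ℕ → ℝ} (hh : Admissible h) :
    ∃ K, ∀ s, Tendsto (fun q => (blockOp t)^[q] h s) atTop (𝓝 K) := by
  obtain ⟨⟨B, hB⟩, ⟨c, hc⟩⟩ := hh
  by_cases hs : ∀ j, Summable (t j)
  · exact ⟨_, tendsto_iterate_blockOp_of_summable ht hs hB⟩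
  · exact ⟨c, tendsto_iterate_blockOp_of_not_summable ht hs h01 hB hc⟩

/-! ### Tails of the zeta series as survival functions. -/

/-- The tail `∑_{m > n} m ^ (-s)` of the series of `zetaSum s`. -/
noncomputable def zetaTail (s : ℝ) (n : ℕ) : ℝ := ∑' j : ℕ, ((j : ℝ) + n + 1) ^ (-s)

theorem tendsto_zetaTail (s : ℝ) : Tendsto (zetaTail s) atTop (𝓝 0) := by
  have h := tendsto_sum_nat_add fun j : ℕ => ((j : ℝ) + 1) ^ (-s)
  exact h.congr fun n => tsum_congr fun j => by push_cast; rfl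

section zetaTail

variable {s : ℝ} (hs : 1 < s)
include hs

theorem summable_rpow_add (n : ℕ) : Summable fun j : ℕ => ((j : ℝ) + n + 1) ^ (-s) := by
  have h := (summable_nat_add_iff (n + 1)).2 (Real.summable_nat_rpow.2 (neg_lt_neg hs))
  simpa [add_assoc] using h

theorem zetaTail_eq (n : ℕ) : zetaTail s n = ((n : ℝ) + 1) ^ (-s) + zetaTail s (n + 1) := by
  rw [zetaTail, (summable_rpow_add hs n).tsum_eq_zero_add, zetaTail]
  congr 1
  · simp
  · refine tsum_congr fun j => ?_
    push_cast
    ring_nf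

theorem zetaTail_pos (n : ℕ) : 0 < zetaTail s n :=
  (summable_rpow_add hs n).tsum_pos (fun j => by positivity) 0 (by positivity)

theorem isSurvival_zetaTail : IsSurvival fun n => zetaTail s n / zetaTail s 0 where
  zero := div_self (zetaTail_pos hs 0).ne'
  anti := strictAnti_nat_of_succ_lt fun n => by
    have h := zetaTail_eq hs n
    have h1 : (0 : ℝ) < ((n : ℝ) + 1) ^ (-s) := by positivity
    exact div_lt_div_of_pos_right (by linarith) (zetaTail_pos hs 0)
  lim := by simpa using (tendsto_zetaTail s).div_const (zetaTail s 0)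

/-- The relative decrease of the tail vanishes at infinity. -/
theorem tendsto_rpow_div_zetaTail :
    Tendsto (fun n : ℕ => ((n : ℝ) + 1) ^ (-s) / zetaTail s n) atTop (𝓝 0) := by
  have hlim : Tendsto (fun n : ℕ => (2 : ℝ) ^ s * ((n : ℝ) + 1)⁻¹) atTop (𝓝 0) := by
    simpa using (tendsto_one_div_add_atTop_nhds_zero_nat (𝕜 := ℝ)).const_mul ((2 : ℝ) ^ s)
  refine squeeze_zero (fun n => div_nonneg (by positivity) (zetaTail_pos hs n).le)
    (fun n => ?_) hlim
  rw [div_le_iff₀ (zetaTail_pos hs n)]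
  -- The first `n + 1` terms of the tail are each at least `(2 * (n + 1)) ^ (-s)`, so the quotient
  -- is at most `2 ^ s / (n + 1)`.
  have h1 : ∑ j ∈ Finset.range (n + 1), ((j : ℝ) + n + 1) ^ (-s) ≤ zetaTail s n :=
    (summable_rpow_add hs n).sum_le_tsum _ fun j _ => by positivity
  have h2 : ∑ j ∈ Finset.range (n + 1), (2 * ((n : ℝ) + 1)) ^ (-s)
      ≤ ∑ j ∈ Finset.range (n + 1), ((j : ℝ) + n + 1) ^ (-s) := by
    refine Finset.sum_le_sum fun j hj => ?_
    have hjn : (j : ℝ) ≤ n := by exact_mod_cast Nat.lt_succ_iff.1 (Finset.mem_range.1 hj)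
    exact Real.rpow_le_rpow_of_nonpos (by positivity) (by linarith) (by linarith)
  rw [Finset.sum_const, Finset.card_range, nsmul_eq_mul,
    Real.mul_rpow (by positivity) (by positivity)] at h2
  calc ((n : ℝ) + 1) ^ (-s)
      = 2 ^ s * ((n : ℝ) + 1)⁻¹ * (((n + 1 : ℕ) : ℝ) * (2 ^ (-s) * ((n : ℝ) + 1) ^ (-s))) := by
        rw [Real.rpow_neg two_pos.le]
        push_cast
        field_simp
    _ ≤ _ := by
        have := h2.trans h1
        gcongr

end zetaTail

/-- Termwise comparison: every term of the `γ`-tail is at most `(n + 1) ^ (-(γ - δ))` times that of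
the `δ`-tail. -/
theorem tendsto_zetaTail_div {γ δ : ℝ} (hδ : 1 < δ) (hδγ : δ < γ) :
    Tendsto (fun n => zetaTail γ n / zetaTail δ n) atTop (𝓝 0) := by
  have hγ := hδ.trans hδγ
  have hlim : Tendsto (fun n : ℕ => ((n : ℝ) + 1) ^ (-(γ - δ))) atTop (𝓝 0) :=
    (tendsto_rpow_neg_atTop (sub_pos.2 hδγ)).comp
      (tendsto_atTop_add_const_right _ _ tendsto_natCast_atTop_atTop)
  refine squeeze_zero (fun n => div_nonneg (zetaTail_pos hγ n).le (zetaTail_pos hδ n).le)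
    (fun n => ?_) hlim
  rw [div_le_iff₀ (zetaTail_pos hδ n), zetaTail, zetaTail, ← tsum_mul_left]
  refine (summable_rpow_add hγ n).tsum_le_tsum (fun j => ?_)
    ((summable_rpow_add hδ n).mul_left _)
  rw [show -γ = -(γ - δ) + -δ by ring, Real.rpow_add (by positivity)]
  have hj : (0 : ℝ) ≤ j := j.cast_nonneg
  exact mul_le_mul_of_nonneg_right (Real.rpow_le_rpow_of_nonpos (by positivity) (by linarith)
    (by linarith)) (by positivity)

/-- The survival functions of the lengths of the blocks of zeros and of the blocks of ones. -/
noncomputable def survival (γ δ : ℝ) (i : Fin 2) (n : ℕ) : ℝ :=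
  zetaTail (if i = 0 then γ else δ) n / zetaTail (if i = 0 then γ else δ) 0

section survival

variable {γ δ : ℝ} (hδ : 1 < δ) (hδγ : δ < γ)
include hδ hδγ

theorem isSurvival_survival (i : Fin 2) : IsSurvival (survival γ δ i) := by
  unfold survival
  split_ifs
  · exact isSurvival_zetaTail (hδ.trans hδγ)
  · exact isSurvival_zetaTail hδ

theorem tendsto_survival_div :
    Tendsto (fun n => survival γ δ 0 n / survival γ δ 1 n) atTop (𝓝 0) := by
  have h := (tendsto_zetaTail_div hδ hδγ).mul_const (zetaTail δ 0 / zetaTail γ 0)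
  rw [zero_mul] at h
  refine h.congr fun n => ?_
  simp only [survival, if_true, one_ne_zero, if_false]
  rw [div_div_div_eq, div_mul_div_comm, mul_comm (zetaTail δ n)]

theorem one_lt_exponent (i : Fin 2) : 1 < if i = 0 then γ else δ := by
  split_ifs <;> linarith

theorem survival_succ_div (i : Fin 2) (n : ℕ) : survival γ δ i (n + 1) / survival γ δ i n
    = zetaTail (if i = 0 then γ else δ) (n + 1) / zetaTail (if i = 0 then γ else δ) n :=
  div_div_div_cancel_right₀ (zetaTail_pos (one_lt_exponent hδ hδγ i) 0).ne' _ _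

theorem survival_sub_div (i : Fin 2) (n : ℕ) :
    (survival γ δ i n - survival γ δ i (n + 1)) / survival γ δ i n
      = ((n : ℝ) + 1) ^ (-if i = 0 then γ else δ) / zetaTail (if i = 0 then γ else δ) n := by
  have h := one_lt_exponent hδ hδγ i
  rw [survival, survival, ← sub_div, div_div_div_cancel_right₀ (zetaTail_pos h 0).ne',
    zetaTail_eq h n, add_sub_cancel_right]

end survival

/-! ### Initial blocks and the Jacobian. -/

/-- The type and the length (minus one) of the initial block of a sequence. -/
noncomputable def blockState (x : Omega) : Fin 2 × ℕ := (x 0, run x - 1)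

theorem run_eq_iff {n : ℕ} (hn : 1 ≤ n) (x : Omega) :
    run x = n ↔ (∀ i < n, x i = x 0) ∧ x n ≠ x 0 := by
  have h0 : x 0 = 0 ∨ x 0 = 1 := by omega
  rcases h0 with h0 | h0
  · have := mem_cylL_iff hn x
    simp only [cylL, Set.mem_ofPred_eq, h0, true_and] at this ⊢
    rw [← this]
    have : x n = 1 ↔ x n ≠ 0 := by omega
    rw [this]
  · have := mem_cylR_iff hn x
    simp only [cylR, Set.mem_ofPred_eq, h0, true_and] at this ⊢
    rw [← this]
    have : x n = 0 ↔ x n ≠ 1 := by omega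
    rw [this]

theorem run_ne_zero_iff (x : Omega) : run x ≠ 0 ↔ x ≠ zeroInf ∧ x ≠ oneInf := by
  constructor
  · intro h
    have h1 := ((run_eq_iff (Nat.one_le_iff_ne_zero.2 h) x).1 rfl).2
    constructor <;> rintro rfl <;> exact h1 rfl
  · rintro ⟨h0, h1⟩ h
    rcases Nat.sInf_eq_zero.1 h with h | h
    · exact h rfl
    · have hx : ∀ n, x n = x 0 := fun n => by
        by_contra hn
        exact (h ▸ hn : n ∈ (∅ : Set ℕ))
      have hx0 : x 0 = 0 ∨ x 0 = 1 := by omega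
      rcases hx0 with hx0 | hx0
      · exact h0 (funext fun n => (hx n).trans hx0)
      · exact h1 (funext fun n => (hx n).trans hx0)

theorem run_cons_self {x : Omega} (hx : run x ≠ 0) : run (cons (x 0) x) = run x + 1 := by
  have h := (run_eq_iff (Nat.one_le_iff_ne_zero.2 hx) x).1 rfl
  refine (run_eq_iff (by omega) _).2 ⟨fun i hi => ?_, h.2⟩
  cases i with
  | zero => rfl
  | succ i => exact h.1 i (by omega)

theorem run_cons_of_ne {x : Omega} {c : Fin 2} (hc : x 0 ≠ c) : run (cons c x) = 1 := by
  refine (run_eq_iff le_rfl _).2 ⟨fun i hi => ?_, hc⟩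
  rw [Nat.lt_one_iff.1 hi]

theorem run_cons_ne_zero {x : Omega} (hx : run x ≠ 0) (c : Fin 2) : run (cons c x) ≠ 0 := by
  by_cases hc : x 0 = c
  · rw [← hc, run_cons_self hx]; omega
  · rw [run_cons_of_ne hc]; omega

theorem blockState_cons_self {x : Omega} (hx : run x ≠ 0) :
    blockState (cons (x 0) x) = ((blockState x).1, (blockState x).2 + 1) := by
  simp only [blockState, run_cons_self hx, Prod.mk.injEq]
  exact ⟨rfl, by omega⟩

theorem blockState_cons_of_ne {x : Omega} {c : Fin 2} (hc : x 0 ≠ c) :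
    blockState (cons c x) = ((blockState x).1 + 1, 0) := by
  simp only [blockState, run_cons_of_ne hc, Prod.mk.injEq]
  refine ⟨?_, trivial⟩
  change c = x 0 + 1
  omega

/-- The summand `1` of the weight is the leading term of the tail, multiplied by `(n + 1) ^ s`. -/
theorem blockWeight_eq {s : ℝ} (hs : 1 < s) (n : ℕ) :
    blockWeight s (n + 1) = ((n : ℝ) + 1) ^ s * zetaTail s n := by
  have h : zetaTail s (n + 1) = ∑' j : ℕ, (((j : ℝ) + 2) + ((n + 1 : ℕ) : ℝ) - 1) ^ (-s) := by
    refine tsum_congr fun j => ?_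
    push_cast
    ring_nf
  rw [blockWeight, ← h, zetaTail_eq hs n, mul_add, ← Real.rpow_add (by positivity)]
  simp

theorem zetaSum_eq (s : ℝ) : zetaSum s = zetaTail s 0 := by
  refine tsum_congr fun j => ?_
  rw [Real.rpow_neg (by positivity)]
  simp

theorem eigenfunction_eq {γ δ : ℝ} (hδ : 1 < δ) (hδγ : δ < γ) {x : Omega} {n : ℕ}
    (hx : run x = n + 1) : eigenfunction γ δ x
      = ((n : ℝ) + 1) ^ (if x 0 = 0 then γ else δ) * zetaTail (if x 0 = 0 then γ else δ) n := by
  rw [eigenfunction, hx]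
  split_ifs
  · exact blockWeight_eq (hδ.trans hδγ) n
  · exact blockWeight_eq hδ n

theorem jacobian_cons_eq {γ δ : ℝ} {x : Omega} (hx : run x ≠ 0) (c : Fin 2) :
    jacobian γ δ (cons c x) = Real.exp (potential γ δ (cons c x)
      + Real.log (eigenfunction γ δ (cons c x)) - Real.log (eigenfunction γ δ x)) := by
  have h1 := (run_ne_zero_iff _).1 (run_cons_ne_zero hx c)
  have h2 := (run_ne_zero_iff _).1 hx
  have h3 : shift (cons c x) = x := rfl
  rw [jacobian, h3, if_neg (by tauto), if_neg (by tauto)]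

/-- The potential contributes `((n + 2) / (n + 1)) ^ (-s)`, which cancels the powers in the
eigenfunctions and leaves the ratio of the tails. -/
theorem jacobian_cons_self {γ δ : ℝ} (hδ : 1 < δ) (hδγ : δ < γ) {x : Omega} (hx : run x ≠ 0) :
    jacobian γ δ (cons (x 0) x) = survival γ δ (blockState x).1 ((blockState x).2 + 1)
      / survival γ δ (blockState x).1 (blockState x).2 := by
  obtain ⟨n, hn⟩ : ∃ n, run x = n + 1 := Nat.exists_eq_succ_of_ne_zero hx
  have hn' := run_cons_self hx
  rw [hn] at hn'
  have hbs : blockState x = (x 0, n) := by simp [blockState, hn]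
  rw [jacobian_cons_eq hx, hbs, survival_succ_div hδ hδγ, eigenfunction_eq hδ hδγ hn,
    eigenfunction_eq hδ hδγ hn']
  have hpot : potential γ δ (cons (x 0) x) = -(if x 0 = 0 then γ else δ)
      * Real.log (((n : ℝ) + 2) / ((n : ℝ) + 1)) := by
    have h2 : ((n + 1 + 1 : ℕ) : ℝ) / (((n + 1 + 1 : ℕ) : ℝ) - 1)
        = ((n : ℝ) + 2) / ((n : ℝ) + 1) := by push_cast; ring_nf
    have h3 : ¬ n + 1 + 1 = 0 := by omega
    have h4 : ¬ n + 1 + 1 = 1 := by omega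
    rw [potential, hn', if_neg h3, if_neg h4, if_neg h4, h2]
    change (if x 0 = 0 then _ else _) = _
    split_ifs <;> rfl
  have hc : cons (x 0) x 0 = x 0 := rfl
  rw [hpot, hc]
  have hs := one_lt_exponent hδ hδγ (x 0)
  set s := if x 0 = 0 then γ else δ
  have h1 := zetaTail_pos hs n
  have h2 := zetaTail_pos hs (n + 1)
  rw [Real.log_mul (by positivity) h1.ne', Real.log_mul (by positivity) h2.ne',
    Real.log_rpow (by positivity), Real.log_rpow (by positivity),
    Real.log_div (by positivity) (by positivity)]
  have h3 : ((n + 1 : ℕ) : ℝ) + 1 = n + 2 := by push_cast; ring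
  rw [h3, ← Real.exp_log (div_pos h2 h1), Real.log_div h2.ne' h1.ne']
  congr 1
  ring

/-- The eigenfunction on a block of length one is the full zeta sum and cancels the potential; what
remains is the reciprocal of the eigenfunction at `x`. -/
theorem jacobian_cons_of_ne {γ δ : ℝ} (hδ : 1 < δ) (hδγ : δ < γ) {x : Omega} (hx : run x ≠ 0)
    {c : Fin 2} (hc : x 0 ≠ c) :
    jacobian γ δ (cons c x) = (survival γ δ (blockState x).1 (blockState x).2
      - survival γ δ (blockState x).1 ((blockState x).2 + 1))
        / survival γ δ (blockState x).1 (blockState x).2 := by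
  obtain ⟨n, hn⟩ : ∃ n, run x = n + 1 := Nat.exists_eq_succ_of_ne_zero hx
  have hn' := run_cons_of_ne hc
  have hbs : blockState x = (x 0, n) := by simp [blockState, hn]
  rw [jacobian_cons_eq hx, hbs, survival_sub_div hδ hδγ, eigenfunction_eq hδ hδγ hn,
    eigenfunction_eq (n := 0) hδ hδγ hn']
  have hc0 : cons c x 0 = c := rfl
  have hpot : potential γ δ (cons c x) = -Real.log (zetaTail (if c = 0 then γ else δ) 0) := by
    rw [potential, hn', hc0, if_neg one_ne_zero, if_pos rfl, if_pos rfl, zetaSum_eq, zetaSum_eq]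
    split_ifs <;> rfl
  rw [hpot, hc0]
  have hs := one_lt_exponent hδ hδγ (x 0)
  set s := if x 0 = 0 then γ else δ
  have h1 := zetaTail_pos hs n
  rw [Real.log_mul (by positivity) h1.ne', Real.log_rpow (by positivity)]
  simp only [Nat.cast_zero, zero_add, Real.one_rpow, one_mul, neg_add_cancel, zero_sub, neg_add]
  rw [Real.exp_add, Real.exp_neg (Real.log _), Real.exp_log h1, div_eq_mul_inv,
    Real.rpow_def_of_pos (by positivity)]
  congr 2
  ring

/-! ### The Ruelle operator as the chain of blocks, and cylinders. -/

theorem iterate_ruelle_congr {W ψ ψ' : Omega → ℝ} (h : ∀ x, run x ≠ 0 → ψ x = ψ' x) (q : ℕ)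
    {x : Omega} (hx : run x ≠ 0) : (ruelle W)^[q] ψ x = (ruelle W)^[q] ψ' x := by
  induction q generalizing x with
  | zero => exact h x hx
  | succ q ih =>
    -- Preimages of nonconstant sequences are nonconstant, so values at the fixed points never
    -- enter.
    rw [Function.iterate_succ_apply', Function.iterate_succ_apply', ruelle_apply, ruelle_apply,
      ih (run_cons_ne_zero hx 0), ih (run_cons_ne_zero hx 1)]

section

variable {γ δ : ℝ} (hδ : 1 < δ) (hδγ : δ < γ)
include hδ hδγ

theorem ruelle_comp_blockState (F : Fin 2 × ℕ → ℝ) {x : Omega} (hx : run x ≠ 0) :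
    ruelle (jacobian γ δ) (fun x => F (blockState x)) x
      = blockOp (survival γ δ) F (blockState x) := by
  have hsum : ruelle (jacobian γ δ) (fun x => F (blockState x)) x
      = jacobian γ δ (cons (x 0) x) * F (blockState (cons (x 0) x))
        + jacobian γ δ (cons (x 0 + 1) x) * F (blockState (cons (x 0 + 1) x)) := by
    rw [ruelle_apply]
    have h0 : x 0 = 0 ∨ x 0 = 1 := by omega
    rcases h0 with h0 | h0
    · rw [h0]; rfl
    · rw [h0, add_comm]; rfl
  have hne : x 0 ≠ x 0 + 1 := by omega
  rw [hsum, jacobian_cons_self hδ hδγ hx, jacobian_cons_of_ne hδ hδγ hx hne,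
    blockState_cons_self hx, blockState_cons_of_ne hne]
  rfl

theorem iterate_ruelle_comp_blockState (F : Fin 2 × ℕ → ℝ) (q : ℕ) {x : Omega}
    (hx : run x ≠ 0) : (ruelle (jacobian γ δ))^[q] (fun x => F (blockState x)) x
      = (blockOp (survival γ δ))^[q] F (blockState x) := by
  induction q generalizing F with
  | zero => rfl
  | succ q ih =>
    rw [Function.iterate_succ_apply, Function.iterate_succ_apply, ← ih]
    exact iterate_ruelle_congr (fun x hx => ruelle_comp_blockState hδ hδγ F hx) q hx

theorem survival_div_mem (i : Fin 2) (n : ℕ) :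
    survival γ δ i (n + 1) / survival γ δ i n ∈ Set.Icc (0 : ℝ) 1
      ∧ (survival γ δ i n - survival γ δ i (n + 1)) / survival γ δ i n ∈ Set.Icc (0 : ℝ) 1 := by
  have ht := isSurvival_survival hδ hδγ i
  have h0 := ht.pos n
  have h1 := ht.nonneg (n + 1)
  have h2 := ht.diff_pos n
  exact ⟨⟨by positivity, (div_le_one h0).2 (by linarith)⟩,
    ⟨by positivity, (div_le_one h0).2 (by linarith)⟩⟩

theorem tendsto_survival_sub_div : Tendsto (fun n => (survival γ δ 1 n - survival γ δ 1 (n + 1))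
    / survival γ δ 1 n) atTop (𝓝 0) := by
  simp_rw [survival_sub_div hδ hδγ]
  exact tendsto_rpow_div_zetaTail hδ

theorem tendsto_survival_succ_div :
    Tendsto (fun n => survival γ δ 1 (n + 1) / survival γ δ 1 n) atTop (𝓝 1) := by
  have h := (tendsto_survival_sub_div hδ hδγ).const_sub 1
  rw [sub_zero] at h
  refine h.congr fun n => ?_
  have := ((isSurvival_survival hδ hδγ 1).pos n).ne'
  field_simp
  ring

/-- The Ruelle operator preserves the class of products of an admissible function of the initial
block with the indicator of a cylinder, and shortens the cylinder. -/
theorem exists_ruelle_cylinder {F : Fin 2 × ℕ → ℝ} (hF : Admissible F) {k : ℕ}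
    (a : Fin (k + 1) → Fin 2) : ∃ F', Admissible F' ∧ ∀ x, run x ≠ 0 →
      ruelle (jacobian γ δ) (fun x => F (blockState x) * (cylinder a).indicator 1 x) x
        = F' (blockState x) * (cylinder (Fin.tail a)).indicator 1 x := by
  obtain ⟨⟨B, hB⟩, ⟨c, hc⟩⟩ := hF
  have hB0 : 0 ≤ B := (abs_nonneg _).trans (hB (0, 0))
  -- The first letter of the word selects one preimage, so only one of the two terms of `blockOp`
  -- remains.
  let F' : Fin 2 × ℕ → ℝ := fun s => if s.1 = a 0
    then survival γ δ s.1 (s.2 + 1) / survival γ δ s.1 s.2 * F (s.1, s.2 + 1)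
    else (survival γ δ s.1 s.2 - survival γ δ s.1 (s.2 + 1)) / survival γ δ s.1 s.2
      * F (s.1 + 1, 0)
  refine ⟨F', ⟨⟨B, fun s => ?_⟩, ?_⟩, fun x hx => ?_⟩
  · obtain ⟨h1, h2⟩ := survival_div_mem hδ hδγ s.1 s.2
    have key : ∀ u ∈ Set.Icc (0 : ℝ) 1, ∀ v, |u * F v| ≤ B := fun u hu v => by
      rw [abs_mul, abs_of_nonneg hu.1]
      exact (mul_le_of_le_one_left (abs_nonneg _) hu.2).trans (hB v)
    simp only [F']
    split_ifs
    · exact key _ h1 _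
    · exact key _ h2 _
  -- A long block of ones grows with probability tending to 1, which keeps the limit `c`; the
  -- switching probability tends to 0.
  · by_cases h1 : 1 = a 0
    · refine ⟨c, ?_⟩
      simp only [F', if_pos h1]
      simpa using (tendsto_survival_succ_div hδ hδγ).mul (hc.comp (tendsto_add_atTop_nat 1))
    · refine ⟨0, ?_⟩
      simp only [F', if_neg h1]
      simpa using (tendsto_survival_sub_div hδ hδγ).mul_const (F (1 + 1, 0))
  · have hind : ∀ d, (cylinder a).indicator (1 : Omega → ℝ) (cons d x)
        = if d = a 0 then (cylinder (Fin.tail a)).indicator 1 x else 0 := by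
      intro d
      have hmem : cons d x ∈ cylinder a ↔ d = a 0 ∧ x ∈ cylinder (Fin.tail a) :=
        Fin.forall_fin_succ
      classical
      simp only [Set.indicator_apply, hmem, ite_and, Pi.one_apply]
    have hsum : ruelle (jacobian γ δ)
        (fun x => F (blockState x) * (cylinder a).indicator 1 x) x
        = jacobian γ δ (cons (a 0) x) * F (blockState (cons (a 0) x))
          * (cylinder (Fin.tail a)).indicator 1 x := by
      rw [ruelle_apply, hind, hind]
      have h0 : a 0 = 0 ∨ a 0 = 1 := by omega
      rcases h0 with h0 | h0 <;> simp [h0, mul_assoc]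
    rw [hsum]
    congr 1
    by_cases hxa : x 0 = a 0
    · have : F' (blockState x) = _ := if_pos hxa
      rw [this, ← hxa, jacobian_cons_self hδ hδγ hx, blockState_cons_self hx]
    · have : F' (blockState x) = _ := if_neg hxa
      rw [this, jacobian_cons_of_ne hδ hδγ hx hxa, blockState_cons_of_ne hxa]

theorem exists_tendsto_iterate_ruelle {F : Fin 2 × ℕ → ℝ} (hF : Admissible F) {k : ℕ}
    (a : Fin k → Fin 2) : ∃ K, ∀ x, run x ≠ 0 → Tendsto (fun q => (ruelle (jacobian γ δ))^[q]
      (fun x => F (blockState x) * (cylinder a).indicator 1 x) x) atTop (𝓝 K) := by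
  induction k generalizing F with
  | zero =>
    obtain ⟨K, hK⟩ := exists_tendsto_iterate_blockOp (isSurvival_survival hδ hδγ)
      (tendsto_survival_div hδ hδγ) hF
    refine ⟨K, fun x hx => (hK (blockState x)).congr fun q => ?_⟩
    rw [← iterate_ruelle_comp_blockState hδ hδγ F q hx]
    have h1 : ∀ x, x ∈ cylinder a := fun x i => i.elim0
    simp [h1]
  | succ k ih =>
    obtain ⟨F', hF', h⟩ := exists_ruelle_cylinder hδ hδγ hF a
    obtain ⟨K, hK⟩ := ih hF' (Fin.tail a)
    refine ⟨K, fun x hx => (tendsto_add_atTop_iff_nat 1).1 ((hK x hx).congr fun q => ?_)⟩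
    rw [Function.iterate_succ_apply]
    exact (iterate_ruelle_congr h q hx).symm

theorem exists_tendsto_iterate_ruelle_indicator {k : ℕ} (a : Fin k → Fin 2) :
    ∃ K, ∀ x, run x ≠ 0 → Tendsto (fun q => (ruelle (jacobian γ δ))^[q]
      ((cylinder a).indicator 1) x) atTop (𝓝 K) := by
  have hF : Admissible fun _ => 1 := ⟨⟨1, fun _ => by simp⟩, ⟨1, tendsto_const_nhds⟩⟩
  simpa using exists_tendsto_iterate_ruelle hδ hδγ hF a

theorem iterate_ruelle_one (q : ℕ) {x : Omega} (hx : run x ≠ 0) :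
    (ruelle (jacobian γ δ))^[q] 1 x = 1 := by
  have h := iterate_ruelle_comp_blockState hδ hδγ (fun _ => 1) q hx
  rw [iterate_blockOp_const (isSurvival_survival hδ hδγ)] at h
  exact h

end

/-! ### Gibbs measures with periodic boundary condition. -/

theorem finsum_fiber_eq (W ψ : Omega → ℝ) (n : ℕ) (z : Omega) :
    ∑ᶠ x ∈ {x : Omega | shift^[n] x = z}, ψ x * ∏ i ∈ Finset.range n, W (shift^[i] x)
      = (ruelle W)^[n] ψ z := by
  induction n generalizing z with
  | zero => simp
  | succ n ih =>
    have hset : {x : Omega | shift^[n + 1] x = z}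
        = {x | shift^[n] x = cons 0 z} ∪ {x | shift^[n] x = cons 1 z} := by
      ext x
      have := Set.ext_iff.1 (preimage_shift z) (shift^[n] x)
      simpa [Function.iterate_succ_apply'] using this
    have hdisj : Disjoint {x : Omega | shift^[n] x = cons 0 z} {x | shift^[n] x = cons 1 z} := by
      refine Set.disjoint_left.2 fun x h0 h1 => ?_
      have h : cons 0 z = cons 1 z := (Set.mem_ofPred.1 h0).symm.trans h1
      exact zero_ne_one (congrFun h 0)
    have hterm : ∀ w, ∑ᶠ x ∈ {x : Omega | shift^[n] x = w},
        ψ x * ∏ i ∈ Finset.range (n + 1), W (shift^[i] x) = W w * (ruelle W)^[n] ψ w := by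
      intro w
      rw [← ih, ← smul_eq_mul, smul_finsum_mem (finite_fiber n w)]
      refine finsum_mem_congr rfl fun x hx => ?_
      rw [Finset.prod_range_succ, show shift^[n] x = w from hx, smul_eq_mul]
      ring
    rw [hset, finsum_mem_union hdisj (finite_fiber _ _) (finite_fiber _ _), hterm, hterm,
      Function.iterate_succ_apply', ruelle_apply]

theorem gibbsSum_eq (W : Omega → ℝ) (n : ℕ) (y : Omega) (F : Set Omega) :
    gibbsSum W n y F = (ruelle W)^[n] (F.indicator 1) (shift^[n] y) :=
  finsum_fiber_eq W _ n _

theorem run_iterate_shift_ne_zero {y : Omega} (hy : y ∈ Function.periodicPts shift)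
    (hy0 : run y ≠ 0) (q : ℕ) : run (shift^[q] y) ≠ 0 := by
  obtain ⟨p, hp, hpy⟩ := hy
  rw [run_ne_zero_iff] at hy0 ⊢
  -- Shifting on to a multiple of the period returns to `y`; an orbit through a fixed point would
  -- force `y` to be that point.
  have hback : shift^[p * q - q] (shift^[q] y) = y := by
    rw [← Function.iterate_add_apply, Nat.sub_add_cancel (Nat.le_mul_of_pos_left q hp)]
    exact (hpy.mul_const q)
  constructor <;> intro h <;> rw [h] at hback
  · exact hy0.1 (hback.symm.trans (Function.iterate_fixed rfl _))
  · exact hy0.2 (hback.symm.trans (Function.iterate_fixed rfl _))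

/-- The orbit is finite, so pointwise convergence is uniform on it and allows an evaluation point
that moves with `n`. -/
theorem tendsto_iterate_shift_of_periodic {u : ℕ → Omega → ℝ} {K : ℝ} {y : Omega}
    (hy : y ∈ Function.periodicPts shift)
    (hu : ∀ q, Tendsto (fun n => u n (shift^[q] y)) atTop (𝓝 K)) :
    Tendsto (fun n => u n (shift^[n] y)) atTop (𝓝 K) := by
  obtain ⟨p, hp, hpy⟩ := hy
  rw [tendsto_def]
  intro s hs
  have h : ∀ᶠ n in atTop, ∀ r ∈ Finset.range p, u n (shift^[r] y) ∈ s :=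
    (Finset.eventually_all _).2 fun r _ => hu r hs
  filter_upwards [h] with n hn
  rw [Set.mem_preimage, ← hpy.iterate_mod_apply n]
  exact hn _ (Finset.mem_range.2 (n.mod_lt hp))

end DoubleHofbauer

theorem mainTheorem4 (γ δ : ℝ) (hδ : 1 < δ) (hδγ : δ < γ) :
    ∃ K : (k : ℕ) → (Fin k → Fin 2) → ℝ,
      (∀ (k : ℕ) (a : Fin k → Fin 2) (n : ℕ), 1 ≤ n → ∀ y ∈ cylL n ∪ cylR n,
        Tendsto (fun q : ℕ => ((ruelle (jacobian γ δ))^[q] ((cylinder a).indicator 1)) y)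
          atTop (𝓝 (K k a))) ∧
      (∀ y ∈ Function.periodicPts shift, y ≠ zeroInf → y ≠ oneInf →
        Tendsto (fun q : ℕ => gibbs (jacobian γ δ) q y (cylinder ![0]))
          atTop (𝓝 (K 1 ![0]))) := by
  choose K hK using fun (k : ℕ) (a : Fin k → Fin 2) =>
    exists_tendsto_iterate_ruelle_indicator hδ hδγ a
  refine ⟨K, fun k a n hn y hy => hK k a y ?_, fun y hy h0 h1 => ?_⟩
  · rcases hy with hy | hy
    · rw [((mem_cylL_iff hn y).1 hy).2]; omega
    · rw [((mem_cylR_iff hn y).1 hy).2]; omega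
  · have hrun := run_iterate_shift_ne_zero hy ((run_ne_zero_iff y).2 ⟨h0, h1⟩)
    refine (tendsto_iterate_shift_of_periodic hy fun q => hK 1 ![0] _ (hrun q)).congr fun q => ?_
    rw [gibbs, gibbsSum_eq, gibbsSum_eq, Set.indicator_univ, iterate_ruelle_one hδ hδγ q (hrun q),
      div_one]
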